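/- There is an absolute constant $c>0$ such that the following holds for every $n$. Let $\mu$ be an isotropic log-concave probability measure on $\mathbb{R}^n$ with essentially continuous density $f=e^{-\psi}$, $\psi:\mathbb{R}^n\to\mathbb{R}\cup\{+\infty\}$. Then $$\int_{\mathbb{R}^n}|\nabla\psi(x)|\,d\mu(x)\geqslant c\sqrt{n}.$$ Here $|\cdot|$ is the Euclidean norm. A Borel probability measure $\mu$ on $\mathbb{R}^n$ is log-concave if $\mu(H)<1$ for every affine hyperplane $H$ and $\mu(\lambda A+(1-\lambda)B)\geqslant\mu(A)^{\lambda}\mu(B)^{1-\lambda}$ for all compact $A,B\subset\mathbb{R}^n$ and $\lambda\in(0,1)$; its density $f:\mathbb{R}^n\to[0,\infty)$ with respect to Lebesgue measure is taken to be log-concave (that is, $f(\lambda x+(1-\lambda)y)\geqslant f(x)^{\lambda}f(y)^{1-\lambda}$ for all $x,y\in\mathbb{R}^n$, $\lambda\in(0,1)$) and upper semicontinuous. The measure $\mu$ is isotropic if its barycenter is the origin and its covariance matrix is the identity $I_n$. The density $f$ is essentially continuous if the set of its discontinuity points has zero $(n-1)$-dimensional Hausdorff measure. The gradient $\nabla\psi$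 exists $\mu$-almost everywhere, and the integral is understood in $[0,\infty]$. -/

import Mathlib

open MeasureTheory ProbabilityTheory
open scoped Pointwise

/-- Log-concave Borel measure on `ℝⁿ`: full-dimensional (every affine hyperplane has measure
less than `1`) and `μ (t A + (1 - t) B) ≥ μ(A) ^ t * μ(B) ^ (1 - t)` for compact `A`, `B`. -/
structure IsLogConcaveMeasure {n : ℕ} (μ : Measure (EuclideanSpace ℝ (Fin n))) : Prop where
  hyperplane_lt_one : ∀ (u : EuclideanSpace ℝ (Fin n)) (b : ℝ), u ≠ 0 →
    μ {x | inner ℝ u x = b} < 1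
  le_measure_add : ∀ (A B : Set (EuclideanSpace ℝ (Fin n))), IsCompact A → IsCompact B →
    ∀ t : ℝ, 0 < t → t < 1 → μ A ^ t * μ B ^ (1 - t) ≤ μ (t • A + (1 - t) • B)

/-- The covariance matrix of a measure on `ℝⁿ`. -/
noncomputable def covMatrix {n : ℕ} (μ : Measure (EuclideanSpace ℝ (Fin n))) :
    Matrix (Fin n) (Fin n) ℝ :=
  Matrix.of fun i j => covariance (fun x => x i) (fun x => x j) μ

/-- Isotropic measure: barycenter at the origin and identity covariance matrix. (The second
condition forces finite second moments, since otherwise a diagonal entry would be `0`.) -/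
structure IsIsotropic {n : ℕ} (μ : Measure (EuclideanSpace ℝ (Fin n))) : Prop where
  barycenter_eq : ∫ x, x ∂μ = 0
  cov_eq : covMatrix μ = 1

/-- The class of upper semicontinuous log-concave functions `f : ℝⁿ → [0, ∞)`. The inequality
says that `{f > 0}` is convex and that `log f`, with `log 0 = -∞`, is concave. -/
structure IsLC {n : ℕ} (f : EuclideanSpace ℝ (Fin n) → ℝ) : Prop where
  nonneg : ∀ x, 0 ≤ f x
  upperSemicontinuous : UpperSemicontinuous f
  logConcave : ∀ (x y : EuclideanSpace ℝ (Fin n)) (t : ℝ), 0 < t → t < 1 →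
    f x ^ t * f y ^ (1 - t) ≤ f (t • x + (1 - t) • y)

/-- The set of discontinuity points of `f` is null for the `(n-1)`-dimensional Hausdorff
measure. -/
def IsEssentiallyContinuous {n : ℕ} (f : EuclideanSpace ℝ (Fin n) → ℝ) : Prop :=
  Measure.hausdorffMeasure ((n : ℝ) - 1) {x | ¬ ContinuousAt f x} = 0

/-! Since `f = exp (-ψ)`, the integral of `|∇ψ|` against `μ` is the total variation `∫ |∇f|`, and
this is bounded below by testing against a vector field. The identity field `x` would be natural, as
its divergence is `n`, but it is unbounded; take `X(x) = x / (1 + a|x|²)` instead. Then `|X| ≤ 1 /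
(2√a)` and `div X ≥ n - (n + 2) a |x|²`. Isotropy gives `∫ |x|² f = n`, so integration by parts `∫ f
div X = -∫ X · ∇f` yields `n - (n + 2) a n ≤ (2√a)⁻¹ ∫ |∇f|`, and `a = 1 / (9n)` gives the constant
`4/9`.

The delicate point is integration by parts, since `f` could jump at the boundary of its support.
Essential continuity excludes this on almost every line parallel to an axis
(`ae_forall_insertCoord_notMem`). On such a line `f` is continuous and log-concave, so there is no
boundary term (`integral_mul_eq_neg_of_logConcave`), and Fubini concludes
(`integral_partial_mul_eq_neg`). -/

/-! ### Calculus on the line. -/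

open Set Filter Topology in
/-- Fundamental theorem of calculus for a continuous function on the line vanishing off an open
convex set, and differentiable from the right on that set. -/
theorem integral_eq_sub_of_rightDifferentiable {F F' : ℝ → ℝ} {S : Set ℝ} (hSo : IsOpen S)
    (hSc : Convex ℝ S) (hF : Continuous F) (hF0 : ∀ x ∉ S, F x = 0)
    (hr : ∀ x ∈ S, DifferentiableWithinAt ℝ F (Ioi x) x) (hF'i : Integrable F')
    (hd : ∀ᵐ t, HasDerivAt F (F' t) t) {c : ℝ} (hc : c ∈ S) (b : ℝ) :
    ∫ t in c..b, F' t = F b - F c := by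
  -- An a.e. derivative alone would not suffice; a right derivative at every interior point does,
  -- and kinks are allowed.
  have inner : ∀ a b : ℝ, a ≤ b → Ioo a b ⊆ S → ∫ t in a..b, F' t = F b - F a := by
    intro a b hab hS
    have hae : ∀ᵐ t, F' t = derivWithin F (Ioi t) t := by
      filter_upwards [hd] with t ht
      exact (ht.hasDerivWithinAt.derivWithin (uniqueDiffWithinAt_Ioi t)).symm
    rw [← intervalIntegral.integral_eq_sub_of_hasDeriv_right_of_le hab hF.continuousOn
      (fun x hx => (hr x (hS hx)).hasDerivWithinAt)
      ((hF'i.congr hae).intervalIntegrable)]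
    exact intervalIntegral.integral_congr_ae (hae.mono fun t ht _ => ht)
  have hzero : ∀ᵐ t, t ∉ S → F' t = 0 := by
    have hfr : ∀ᵐ t, t ∉ frontier S :=
      measure_eq_zero_iff_ae_notMem.mp (hSc.addHaar_frontier volume)
    filter_upwards [hd, hfr] with t ht htf htS
    have htc : t ∉ closure S := fun h => htf ⟨h, by rwa [hSo.interior_eq]⟩
    have : F =ᶠ[𝓝 t] fun _ => 0 := by
      filter_upwards [isClosed_closure.isOpen_compl.mem_nhds htc] with y hy
      exact hF0 y fun h => hy (subset_closure h)
    exact ht.unique ((hasDerivAt_const t (0 : ℝ)).congr_of_eventuallyEq this)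
  have outer : ∀ a b : ℝ, (∀ t ∈ uIcc a b, t ∉ S) → ∫ t in a..b, F' t = F b - F a := by
    intro a b h
    rw [hF0 _ (h a left_mem_uIcc), hF0 _ (h b right_mem_uIcc), sub_zero,
      ← intervalIntegral.integral_zero (a := a) (b := b) (μ := volume)]
    exact intervalIntegral.integral_congr_ae
      (hzero.mono fun t ht htm => ht (h t (uIoc_subset_uIcc htm)))
  have hint : ∀ a b : ℝ, IntervalIntegrable F' volume a b := fun a b => hF'i.intervalIntegrable
  by_cases hb : b ∈ S
  · rcases le_total c b with h | h
    · exact inner c b h (Ioo_subset_Icc_self.trans (hSc.ordConnected.out hc hb))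
    · rw [intervalIntegral.integral_symm,
        inner b c h (Ioo_subset_Icc_self.trans (hSc.ordConnected.out hb hc)), neg_sub]
  rcases le_total c b with h | h
  -- `β` is the first exit from `S`; by convexity the path never re-enters.
  · obtain ⟨β, ⟨⟨hcβ, hβb⟩, hβS⟩, hβ⟩ := (isCompact_Icc.inter_right
      hSo.isClosed_compl).exists_isLeast (⟨b, right_mem_Icc.2 h, hb⟩ : (Icc c b ∩ Sᶜ).Nonempty)
    have h1 : Ioo c β ⊆ S := fun t ht => by
      by_contra hn
      exact absurd (hβ ⟨⟨ht.1.le, ht.2.le.trans hβb⟩, hn⟩) (not_le.2 ht.2)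
    have h2 : ∀ t ∈ uIcc β b, t ∉ S := fun t ht htS => by
      rw [uIcc_of_le hβb] at ht
      exact hβS (hSc.ordConnected.out hc htS ⟨hcβ, ht.1⟩)
    rw [← intervalIntegral.integral_add_adjacent_intervals (hint c β) (hint β b),
      inner c β hcβ h1, outer β b h2]
    ring
  · obtain ⟨β, ⟨⟨hbβ, hβc⟩, hβS⟩, hβ⟩ := (isCompact_Icc.inter_right
      hSo.isClosed_compl).exists_isGreatest (⟨b, left_mem_Icc.2 h, hb⟩ : (Icc b c ∩ Sᶜ).Nonempty)
    have h1 : Ioo β c ⊆ S := fun t ht => by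
      by_contra hn
      exact absurd (hβ ⟨⟨hbβ.trans ht.1.le, ht.2.le⟩, hn⟩) (not_le.2 ht.1)
    have h2 : ∀ t ∈ uIcc β b, t ∉ S := fun t ht htS => by
      rw [uIcc_of_ge hbβ] at ht
      exact hβS (hSc.ordConnected.out htS hc ⟨ht.2, hβc⟩)
    rw [← intervalIntegral.integral_add_adjacent_intervals (hint c β) (hint β b),
      intervalIntegral.integral_symm, inner β c hβc h1, outer β b h2]
    ring

open Set Filter Topology in
/-- The integral over the line of the derivative of an integrable function is zero. -/
theorem integral_eq_zero_of_rightDifferentiable {F F' : ℝ → ℝ} {S : Set ℝ} (hSo : IsOpen S)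
    (hSc : Convex ℝ S) (hF : Continuous F) (hF0 : ∀ x ∉ S, F x = 0)
    (hr : ∀ x ∈ S, DifferentiableWithinAt ℝ F (Ioi x) x) (hFi : Integrable F)
    (hF'i : Integrable F') (hd : ∀ᵐ t, HasDerivAt F (F' t) t) : ∫ t, F' t = 0 := by
  rcases S.eq_empty_or_nonempty with rfl | ⟨c, hc⟩
  · have hFz : F = fun _ => 0 := funext fun x => hF0 x (notMem_empty x)
    subst hFz
    have : F' =ᵐ[volume] fun _ => 0 := hd.mono fun t ht => ht.unique (hasDerivAt_const t 0)
    rw [integral_congr_ae this, integral_zero]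
  have ftc := fun b =>
    integral_eq_sub_of_rightDifferentiable hSo hSc hF hF0 hr hF'i hd hc b
  have ftc' : ∀ b, F b = F c + ∫ t in c..b, F' t := fun b => by rw [ftc b]; ring
  have top : Tendsto (fun b => ∫ t in c..b, F' t) atTop (𝓝 (∫ t in Ioi c, F' t)) :=
    intervalIntegral_tendsto_integral_Ioi c hF'i.integrableOn tendsto_id
  have bot : Tendsto (fun b => ∫ t in b..c, F' t) atBot (𝓝 (∫ t in Iic c, F' t)) :=
    intervalIntegral_tendsto_integral_Iic c hF'i.integrableOn tendsto_id
  have htop : F c + ∫ t in Ioi c, F' t = 0 := by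
    have hT : Tendsto F atTop (𝓝 (F c + ∫ t in Ioi c, F' t)) := by
      rw [funext ftc']
      simpa using tendsto_const_nhds.add top
    -- A limit at infinity of an integrable function must be zero.
    refine IntegrableAtFilter.eq_zero_of_tendsto (μ := volume)
      ⟨univ, univ_mem, hFi.integrableOn⟩ (fun s hs => ?_) hT
    obtain ⟨b, hb⟩ := mem_atTop_sets.1 hs
    rw [← top_le_iff, ← Real.volume_Ici (a := b)]
    exact measure_mono hb
  have hbot : F c - ∫ t in Iic c, F' t = 0 := by
    have hT : Tendsto F atBot (𝓝 (F c - ∫ t in Iic c, F' t)) := by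
      have : F = fun b => F c - ∫ t in b..c, F' t := funext fun b => by
        rw [intervalIntegral.integral_symm, ftc b]; ring
      rw [this]
      simpa using tendsto_const_nhds.sub bot
    refine IntegrableAtFilter.eq_zero_of_tendsto (μ := volume)
      ⟨univ, univ_mem, hFi.integrableOn⟩ (fun s hs => ?_) hT
    obtain ⟨b, hb⟩ := mem_atBot_sets.1 hs
    rw [← top_le_iff, ← Real.volume_Iic (a := b)]
    exact measure_mono hb
  rw [← intervalIntegral.integral_Iic_add_Ioi hF'i.integrableOn hF'i.integrableOn (b := c)]
  linarith

/-- The logarithm of a log-concave function is concave where the function is positive. -/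
theorem concaveOn_log_of_logConcave {E : Type*} [AddCommGroup E] [Module ℝ E] {f : E → ℝ}
    (h : ∀ (x y : E) (t : ℝ), 0 < t → t < 1 → f x ^ t * f y ^ (1 - t) ≤ f (t • x + (1 - t) • y)) :
    ConcaveOn ℝ {x | 0 < f x} fun x => Real.log (f x) := by
  have key : ∀ x y : E, 0 < f x → 0 < f y → ∀ a b : ℝ, 0 < a → 0 < b → a + b = 1 →
      0 < f (a • x + b • y) ∧
        a * Real.log (f x) + b * Real.log (f y) ≤ Real.log (f (a • x + b • y)) := by
    intro x y hx hy a b ha hb hab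
    obtain rfl : b = 1 - a := by linarith
    have hpos : 0 < f x ^ a * f y ^ (1 - a) := by positivity
    have hle := h x y a ha (by linarith)
    refine ⟨hpos.trans_le hle, ?_⟩
    have := Real.log_le_log hpos hle
    rwa [Real.log_mul (by positivity) (by positivity), Real.log_rpow hx, Real.log_rpow hy] at this
  have hc : Convex ℝ {x | 0 < f x} :=
    convex_iff_forall_pos.2 fun x hx y hy a b ha hb hab => (key x y hx hy a b ha hb hab).1
  exact concaveOn_iff_forall_pos.2
    ⟨hc, fun x hx y hy a b ha hb hab => (key x y hx hy a b ha hb hab).2⟩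

open Set Filter Topology in
/-- Integration by parts on the line against a continuous log-concave function. -/
theorem integral_mul_eq_neg_of_logConcave {g g' φ φ' : ℝ → ℝ} (hg0 : ∀ t, 0 ≤ g t)
    (hgc : Continuous g)
    (hlc : ∀ x y t : ℝ, 0 < t → t < 1 → g x ^ t * g y ^ (1 - t) ≤ g (t • x + (1 - t) • y))
    (hgi : Integrable g) (hg'i : Integrable g') (hd : ∀ᵐ t, HasDerivAt g (g' t) t)
    (hφ : ∀ t, HasDerivAt φ (φ' t) t) (hφ'c : Continuous φ') {C : ℝ} (hφb : ∀ t, |φ t| ≤ C)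
    (hφ'b : ∀ t, |φ' t| ≤ C) : ∫ t, φ' t * g t = -∫ t, φ t * g' t := by
  have hφc : Continuous φ := continuous_iff_continuousAt.2 fun t => (hφ t).continuousAt
  have hconc := concaveOn_log_of_logConcave hlc
  have hSo : IsOpen {x | 0 < g x} := isOpen_lt continuous_const hgc
  have hi1 : Integrable fun t => φ' t * g t :=
    hgi.bdd_mul hφ'c.aestronglyMeasurable (.of_forall hφ'b)
  have hi2 : Integrable fun t => φ t * g' t :=
    hg'i.bdd_mul hφc.aestronglyMeasurable (.of_forall hφb)
  have hi3 : Integrable fun t => φ t * g t :=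
    hgi.bdd_mul hφc.aestronglyMeasurable (.of_forall hφb)
  have hz : ∫ t, (φ' t * g t + φ t * g' t) = 0 := by
    refine integral_eq_zero_of_rightDifferentiable (F := fun t => φ t * g t) hSo hconc.1
      (hφc.mul hgc) (fun x hx => ?_) (fun x hx => ?_) hi3 (hi1.add hi2) ?_
    · simp [le_antisymm (not_lt.1 hx) (hg0 x)]
    -- A concave function has one-sided derivatives at interior points.
    · have hlog : DifferentiableWithinAt ℝ (fun x => Real.log (g x)) (Ioi x) x := by
        have := hconc.neg.differentiableWithinAt_Ioi_of_mem_interior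
          (x := x) (by rwa [hSo.interior_eq])
        simpa using this.neg
      have hg : DifferentiableWithinAt ℝ g (Ioi x) x := by
        refine hlog.exp.congr_of_eventuallyEq ?_ (Real.exp_log hx).symm
        filter_upwards [nhdsWithin_le_nhds (hSo.mem_nhds hx)] with y hy
        exact (Real.exp_log hy).symm
      exact (hφ x).differentiableAt.differentiableWithinAt.mul hg
    · filter_upwards [hd] with t ht
      exact (hφ t).mul ht
  rw [integral_add hi1 hi2] at hz
  linarith

/-! ### Almost everywhere differentiability and the logarithmic gradient. -/

open Set Filter Topology in
/-- A log-concave function on a finite-dimensional space is differentiable almost everywhere. -/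
theorem ae_differentiableAt_of_logConcave {E : Type*} [NormedAddCommGroup E] [NormedSpace ℝ E]
    [FiniteDimensional ℝ E] [MeasurableSpace E] [BorelSpace E] (ν : Measure E)
    [ν.IsAddHaarMeasure] {f : E → ℝ} (hf0 : ∀ x, 0 ≤ f x)
    (h : ∀ (x y : E) (t : ℝ), 0 < t → t < 1 → f x ^ t * f y ^ (1 - t) ≤ f (t • x + (1 - t) • y)) :
    ∀ᵐ x ∂ν, DifferentiableAt ℝ f x := by
  have hconc := concaveOn_log_of_logConcave h
  set S := {x | 0 < f x} with hS
  have hfr : ∀ᵐ x ∂ν, x ∉ frontier S :=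
    measure_eq_zero_iff_ae_notMem.mp (hconc.1.addHaar_frontier ν)
  -- The concave `log f` is locally Lipschitz inside `S`, so Rademacher's theorem applies locally.
  have hin : ∀ᵐ x ∂ν, x ∈ interior S → DifferentiableAt ℝ f x := by
    rw [ae_iff]
    refine measure_null_of_locally_null _ fun x hx => ?_
    have hxS : x ∈ interior S := by
      by_contra hn
      exact hx fun h => absurd h hn
    obtain ⟨K, t, ht, hLip⟩ := hconc.locallyLipschitzOn_interior hxS
    rw [isOpen_interior.nhdsWithin_eq hxS] at ht
    obtain ⟨u, hut, huo, hxu⟩ := mem_nhds_iff.1 (inter_mem ht (isOpen_interior.mem_nhds hxS))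
    refine ⟨_, inter_mem_nhdsWithin _ (huo.mem_nhds hxu), ?_⟩
    have hLu := hLip.mono (hut.trans inter_subset_left)
    have hae := hLu.ae_differentiableWithinAt_of_mem (μ := ν)
    refine measure_mono_null (fun y hy => ?_) (ae_iff.1 hae)
    change ¬ (y ∈ u → DifferentiableWithinAt ℝ _ u y)
    intro hdy
    refine hy.1 fun _ => ?_
    have hd := ((hdy hy.2).differentiableAt (huo.mem_nhds hy.2)).exp
    refine hd.congr_of_eventuallyEq ?_
    filter_upwards [huo.mem_nhds hy.2] with z hz
    exact (Real.exp_log (show 0 < f z from (interior_subset (hut hz).2 : z ∈ S))).symm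
  filter_upwards [hfr, hin] with x hx1 hx2
  by_cases hx : x ∈ closure S
  · exact hx2 (by_contra fun hn => hx1 ⟨hx, hn⟩)
  · refine (differentiableAt_const (0 : ℝ)).congr_of_eventuallyEq ?_
    filter_upwards [isClosed_closure.isOpen_compl.mem_nhds hx] with y hy
    exact le_antisymm (not_lt.1 fun h => hy (subset_closure h)) (hf0 y)

/-- The differential of a nonnegative function is the function times the differential of its
logarithm. -/
theorem enorm_fderiv_eq_mul_enorm_gradient_log {E : Type*} [NormedAddCommGroup E]
    [InnerProductSpace ℝ E] [CompleteSpace E] {f : E → ℝ} (hf0 : ∀ x, 0 ≤ f x) {x : E}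
    (hx : DifferentiableAt ℝ f x) :
    ‖fderiv ℝ f x‖ₑ = ENNReal.ofReal (f x) * ‖gradient (fun y => -Real.log (f y)) x‖ₑ := by
  rcases (hf0 x).eq_or_lt with h0 | hpos
  -- A zero of `f` is a minimum, so both sides vanish there.
  · have : IsLocalMin f x := Filter.Eventually.of_forall fun y => h0 ▸ hf0 y
    rw [this.fderiv_eq_zero, ← h0, ENNReal.ofReal_zero, zero_mul, ← ofReal_norm, norm_zero, ENNReal.ofReal_zero]
  · have hgrad : ‖gradient (fun y => -Real.log (f y)) x‖ₑ = ‖(f x)⁻¹ • fderiv ℝ f x‖ₑ := by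
      rw [gradient, LinearIsometryEquiv.enorm_map, fderiv_fun_neg, fderiv.log hx hpos.ne', enorm_neg]
    rw [hgrad, ← Real.enorm_of_nonneg hpos.le, ← enorm_smul, smul_smul,
      mul_inv_cancel₀ hpos.ne', one_smul]

/-- If `ENNReal.ofReal a = exp (-ψ)` then the real value of `ψ` is `-log a`. -/
theorem toReal_eq_neg_log_of_ofReal_eq_exp_neg {a : ℝ} {ψ : EReal} (ha : 0 ≤ a)
    (h : ENNReal.ofReal a = EReal.exp (-ψ)) : ψ.toReal = -Real.log a := by
  induction ψ using EReal.rec with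
  | bot => simp at h
  -- Default values agree: `⊤.toReal = 0 = -Real.log 0`.
  | top =>
    have : a = 0 := le_antisymm (by simpa using h) ha
    simp [this]
  | coe r =>
    rw [← EReal.coe_neg, EReal.exp_coe] at h
    rw [(ENNReal.ofReal_eq_ofReal_iff ha (Real.exp_pos _).le).1 h]
    simp

/-! ### Slicing along a coordinate axis. -/

section Fubini

variable {m : ℕ}

/-- The measurable equivalence splitting off the `i`-th coordinate of Euclidean space. -/
noncomputable def insertCoord (i : Fin (m + 1)) :
    ℝ × (Fin m → ℝ) ≃ᵐ EuclideanSpace ℝ (Fin (m + 1)) :=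
  (MeasurableEquiv.piFinSuccAbove (fun _ => ℝ) i).symm.trans (MeasurableEquiv.toLp 2 _)

theorem insertCoord_apply (i : Fin (m + 1)) (p : ℝ × (Fin m → ℝ)) :
    insertCoord i p = WithLp.toLp 2 (i.insertNth p.1 p.2 : Fin (m + 1) → ℝ) := rfl

theorem volume_preserving_insertCoord (i : Fin (m + 1)) :
    MeasurePreserving (insertCoord i) volume volume :=
  (PiLp.volume_preserving_toLp _).comp
    (volume_preserving_piFinSuccAbove (fun _ : Fin (m + 1) => ℝ) i).symm

theorem insertCoord_eq_add_smul (i : Fin (m + 1)) (t : ℝ) (y : Fin m → ℝ) :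
    insertCoord i (t, y) = insertCoord i (0, y) + t • EuclideanSpace.single i 1 := by
  ext j
  refine Fin.succAboveCases i ?_ (fun k => ?_) j
  · simp [insertCoord_apply]
  · simp [insertCoord_apply, Fin.succAbove_ne]

theorem insertCoord_combo (i : Fin (m + 1)) (a b s : ℝ) (y : Fin m → ℝ) :
    insertCoord i (s • a + (1 - s) • b, y) =
      s • insertCoord i (a, y) + (1 - s) • insertCoord i (b, y) := by
  rw [insertCoord_eq_add_smul i (_ + _), insertCoord_eq_add_smul i a, insertCoord_eq_add_smul i b]
  module

theorem hasDerivAt_insertCoord (i : Fin (m + 1)) (t : ℝ) (y : Fin m → ℝ) :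
    HasDerivAt (fun s => insertCoord i (s, y)) (EuclideanSpace.single i 1) t := by
  rw [funext fun s => insertCoord_eq_add_smul i s y]
  simpa using ((hasDerivAt_id t).smul_const
    (EuclideanSpace.single i (1 : ℝ) : EuclideanSpace ℝ (Fin (m + 1)))).const_add
      (insertCoord i (0, y))

/-- Almost every line parallel to a coordinate axis avoids a set of zero codimension one
Hausdorff measure. -/
theorem ae_forall_insertCoord_notMem (i : Fin (m + 1)) {D : Set (EuclideanSpace ℝ (Fin (m + 1)))}
    (hD : Measure.hausdorffMeasure (m : ℝ) D = 0) :
    ∀ᵐ y : Fin m → ℝ, ∀ t : ℝ, insertCoord i (t, y) ∉ D := by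
  -- Dropping a coordinate is 1-Lipschitz, so the shadow of `D` is Lebesgue null.
  have hL : LipschitzWith 1
      fun (x : EuclideanSpace ℝ (Fin (m + 1))) (j : Fin m) => x (i.succAbove j) := by
    refine LipschitzWith.of_dist_le_mul fun x x' => ?_
    rw [NNReal.coe_one, one_mul, dist_pi_le_iff dist_nonneg]
    intro j
    rw [dist_eq_norm, dist_eq_norm]
    exact PiLp.norm_apply_le (x - x') (i.succAbove j)
  have h0 := hL.hausdorffMeasure_image_le (Nat.cast_nonneg m) D
  rw [hD, mul_zero, nonpos_iff_eq_zero] at h0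
  have hv : volume ((fun (x : EuclideanSpace ℝ (Fin (m + 1))) (j : Fin m) =>
      x (i.succAbove j)) '' D) = 0 := by
    rw [← hausdorffMeasure_pi_real, Fintype.card_fin]
    exact h0
  filter_upwards [measure_eq_zero_iff_ae_notMem.mp hv] with y hy t ht
  exact hy ⟨_, ht, by ext j; simp [insertCoord_apply]⟩

/-- Integration by parts along a coordinate direction against an essentially continuous
log-concave function with integrable differential. -/
theorem integral_partial_mul_eq_neg {f φ : EuclideanSpace ℝ (Fin (m + 1)) → ℝ} (hf : IsLC f)
    (hD : IsEssentiallyContinuous f) (hfi : Integrable f) (i : Fin (m + 1))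
    (hf'i : Integrable fun x => fderiv ℝ f x (EuclideanSpace.single i 1))
    (hφ : ContDiff ℝ 1 φ) {C : ℝ} (hφb : ∀ x, |φ x| ≤ C)
    (hφ'b : ∀ x, |fderiv ℝ φ x (EuclideanSpace.single i 1)| ≤ C) :
    ∫ x, fderiv ℝ φ x (EuclideanSpace.single i 1) * f x =
      -∫ x, φ x * fderiv ℝ f x (EuclideanSpace.single i 1) := by
  have hD' : Measure.hausdorffMeasure (m : ℝ) {x | ¬ ContinuousAt f x} = 0 := by
    simpa [IsEssentiallyContinuous] using hD
  set e : EuclideanSpace ℝ (Fin (m + 1)) := EuclideanSpace.single i 1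
  have hφ'c : Continuous fun x => fderiv ℝ φ x e :=
    (hφ.continuous_fderiv one_ne_zero).clm_apply continuous_const
  have mp := volume_preserving_insertCoord (m := m) i
  have emb := (insertCoord (m := m) i).measurableEmbedding
  have hi1 : Integrable fun x => fderiv ℝ φ x e * f x :=
    hfi.bdd_mul hφ'c.aestronglyMeasurable (.of_forall hφ'b)
  have hi2 : Integrable fun x => φ x * fderiv ℝ f x e :=
    hf'i.bdd_mul hφ.continuous.aestronglyMeasurable (.of_forall hφb)
  have trans : ∀ {u : EuclideanSpace ℝ (Fin (m + 1)) → ℝ}, Integrable u →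
      Integrable (fun p => u (insertCoord i p)) ((volume : Measure ℝ).prod volume) :=
    fun {u} hu => (mp.integrable_comp_emb emb).2 hu
  have fub : ∀ {u : EuclideanSpace ℝ (Fin (m + 1)) → ℝ}, Integrable u →
      ∫ x, u x = ∫ y, ∫ t, u (insertCoord i (t, y)) := fun {u} hu => by
    rw [← mp.integral_comp emb]
    exact integral_prod_symm _ (trans hu)
  have hdiff : ∀ᵐ y : Fin m → ℝ, ∀ᵐ t : ℝ, DifferentiableAt ℝ f (insertCoord i (t, y)) := by
    have h1 := mp.quasiMeasurePreserving.ae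
      (ae_differentiableAt_of_logConcave volume hf.nonneg hf.logConcave)
    have h2 : ∀ᵐ p : (Fin m → ℝ) × ℝ, DifferentiableAt ℝ f (insertCoord i p.swap) :=
      (Measure.measurePreserving_swap (μ := (volume : Measure (Fin m → ℝ)))
        (ν := (volume : Measure ℝ))).quasiMeasurePreserving.ae h1
    exact Measure.ae_ae_of_ae_prod h2
  rw [fub hi1, fub hi2, ← integral_neg]
  refine integral_congr_ae ?_
  filter_upwards [ae_forall_insertCoord_notMem i hD', hdiff, (trans hfi).prod_left_ae,
    (trans hf'i).prod_left_ae] with y hcont hdy hy1 hy2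
  refine integral_mul_eq_neg_of_logConcave (g := fun t => f (insertCoord i (t, y)))
    (φ := fun t => φ (insertCoord i (t, y))) (C := C) (fun t => hf.nonneg _)
    (continuous_iff_continuousAt.2 fun t => ?_) (fun a b s hs hs1 => ?_) hy1 hy2 ?_
    (fun t => ?_) ?_ (fun t => hφb _) (fun t => hφ'b _)
  · exact ContinuousAt.comp (f := fun s => insertCoord i (s, y)) (not_not.1 (hcont t))
      (hasDerivAt_insertCoord i t y).continuousAt
  · rw [insertCoord_combo]
    exact hf.logConcave _ _ s hs hs1
  · filter_upwards [hdy] with t ht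
    exact ht.hasFDerivAt.comp_hasDerivAt t (hasDerivAt_insertCoord i t y)
  · exact (hφ.differentiable one_ne_zero _).hasFDerivAt.comp_hasDerivAt t
      (hasDerivAt_insertCoord i t y)
  · exact hφ'c.comp (continuous_iff_continuousAt.2 fun t =>
      (hasDerivAt_insertCoord i t y).continuousAt)

end Fubini

/-! ### Moments under isotropy. -/

/-- Second moment of an isotropic probability measure. -/
theorem IsIsotropic.integral_norm_sq {n : ℕ} {μ : Measure (EuclideanSpace ℝ (Fin n))}
    [IsProbabilityMeasure μ] (h : IsIsotropic μ) :
    Integrable (fun x => ‖x‖ ^ 2) μ ∧ ∫ x, ‖x‖ ^ 2 ∂μ = n := by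
  have hcov : ∀ i, ∫ x, (x i - ∫ y, y i ∂μ) * (x i - ∫ y, y i ∂μ) ∂μ = 1 := fun i => by
    have := congrFun (congrFun h.cov_eq i) i
    rwa [Matrix.one_apply_eq] at this
  have hL2 : ∀ i, MemLp (fun x : EuclideanSpace ℝ (Fin n) => x i) 2 μ := fun i => by
    have hint : Integrable (fun x : EuclideanSpace ℝ (Fin n) => (x i - ∫ y, y i ∂μ) ^ 2) μ := by
      -- A non-integrable square would have integral `0` by default, contradicting variance `1`.
      by_contra hn
      have := hcov i
      simp_rw [← sq] at this
      rw [integral_undef hn] at this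
      norm_num at this
    have hm : MemLp (fun x : EuclideanSpace ℝ (Fin n) => x i - ∫ y, y i ∂μ) 2 μ :=
      (memLp_two_iff_integrable_sq (by fun_prop)).2 hint
    simpa [Pi.add_def] using hm.add (memLp_const (∫ y, y i ∂μ))
  have hid : Integrable (fun x : EuclideanSpace ℝ (Fin n) => x) μ := by
    rw [← memLp_one_iff_integrable]
    exact (MemLp.of_eval_piLp hL2).mono_exponent one_le_two
  have hmean : ∀ i, ∫ x, x i ∂μ = 0 := fun i => by
    have := (EuclideanSpace.proj (𝕜 := ℝ) i).integral_comp_comm hid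
    rw [h.barycenter_eq] at this
    simpa using this
  have hsq : ∀ i, Integrable (fun x : EuclideanSpace ℝ (Fin n) => (x i) ^ 2) μ := fun i =>
    (hL2 i).integrable_sq
  simp_rw [EuclideanSpace.real_norm_sq_eq]
  refine ⟨integrable_finsetSum _ fun i _ => hsq i, ?_⟩
  rw [integral_finsetSum _ fun i _ => hsq i]
  have : ∀ i, ∫ x : EuclideanSpace ℝ (Fin n), (x i) ^ 2 ∂μ = 1 := fun i => by
    have := hcov i
    simp_rw [hmean i, sub_zero, ← sq] at this
    exact this
  simp [this]

/-! ### The truncated radial field. -/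

section Field

variable {n : ℕ}

theorem contDiff_coord_div (a : ℝ) (ha : 0 < a) (i : Fin n) :
    ContDiff ℝ 1 fun x : EuclideanSpace ℝ (Fin n) => x i * (1 + a * ‖x‖ ^ 2)⁻¹ := by
  have h1 : ContDiff ℝ 1 fun x : EuclideanSpace ℝ (Fin n) => x i :=
    (EuclideanSpace.proj (𝕜 := ℝ) i).contDiff
  have h2 : ContDiff ℝ 1 fun x : EuclideanSpace ℝ (Fin n) => 1 + a * ‖x‖ ^ 2 :=
    contDiff_const.add (contDiff_const.mul (contDiff_norm_sq ℝ))
  exact h1.mul (h2.inv fun x => by positivity)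

theorem fderiv_coord_div_single (a : ℝ) (ha : 0 < a) (i : Fin n) (x : EuclideanSpace ℝ (Fin n)) :
    fderiv ℝ (fun x : EuclideanSpace ℝ (Fin n) => x i * (1 + a * ‖x‖ ^ 2)⁻¹) x
      (EuclideanSpace.single i 1) =
      (1 + a * ‖x‖ ^ 2)⁻¹ - 2 * a * x i ^ 2 * ((1 + a * ‖x‖ ^ 2)⁻¹) ^ 2 := by
  have h1 : HasFDerivAt (fun x : EuclideanSpace ℝ (Fin n) => x i)
      (EuclideanSpace.proj (𝕜 := ℝ) i) x := (EuclideanSpace.proj (𝕜 := ℝ) i).hasFDerivAt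
  have h2 : HasFDerivAt (fun x : EuclideanSpace ℝ (Fin n) => 1 + a * ‖x‖ ^ 2)
      (a • (2 • innerSL ℝ x)) x :=
    ((hasStrictFDerivAt_norm_sq x).hasFDerivAt.const_mul a).const_add 1
  have hpos : 1 + a * ‖x‖ ^ 2 ≠ 0 := by positivity
  have h3 := h1.mul ((hasDerivAt_inv hpos).comp_hasFDerivAt x h2)
  simp only [Function.comp_def, Pi.mul_def] at h3
  rw [h3.fderiv]
  simp [EuclideanSpace.inner_single_right]
  ring

theorem norm_mul_inv_le (a : ℝ) (ha : 0 < a) (r : ℝ) :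
    r * (1 + a * r ^ 2)⁻¹ ≤ (2 * √a)⁻¹ := by
  have hs : 0 < √a := Real.sqrt_pos.2 ha
  rw [← div_eq_mul_inv, div_le_iff₀ (by positivity), inv_mul_eq_div, le_div_iff₀ (by positivity)]
  -- This is `2√a r ≤ 1 + a r²`.
  nlinarith [sq_nonneg (√a * r - 1), Real.sq_sqrt ha.le]

theorem abs_coord_div_le (a : ℝ) (ha : 0 < a) (i : Fin n) (x : EuclideanSpace ℝ (Fin n)) :
    |x i * (1 + a * ‖x‖ ^ 2)⁻¹| ≤ (2 * √a)⁻¹ := by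
  have hp : 0 < 1 + a * ‖x‖ ^ 2 := by positivity
  rw [abs_mul, abs_of_pos (inv_pos.2 hp)]
  exact (mul_le_mul_of_nonneg_right (PiLp.norm_apply_le x i) (inv_pos.2 hp).le).trans
    (norm_mul_inv_le a ha ‖x‖)

theorem abs_fderiv_coord_div_single_le (a : ℝ) (ha : 0 < a) (i : Fin n)
    (x : EuclideanSpace ℝ (Fin n)) :
    |fderiv ℝ (fun x : EuclideanSpace ℝ (Fin n) => x i * (1 + a * ‖x‖ ^ 2)⁻¹) x
      (EuclideanSpace.single i 1)| ≤ 2 := by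
  rw [fderiv_coord_div_single a ha]
  set q := a * ‖x‖ ^ 2 with hq
  have hq0 : 0 ≤ q := by positivity
  have hx : a * x i ^ 2 ≤ q := by
    have : x i ^ 2 ≤ ‖x‖ ^ 2 := by
      rw [← sq_abs]
      exact pow_le_pow_left₀ (abs_nonneg _) (PiLp.norm_apply_le x i) 2
    exact mul_le_mul_of_nonneg_left this ha.le
  have hx0 : 0 ≤ a * x i ^ 2 := by positivity
  set w := (1 + q)⁻¹ with hw
  have hw0 : 0 ≤ w := by positivity
  have hwq : w + w * q = 1 := by rw [hw]; field_simp
  have hwq0 : 0 ≤ w * q := by positivity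
  have h1 : a * x i ^ 2 * w ^ 2 ≤ q * w ^ 2 := mul_le_mul_of_nonneg_right hx (by positivity)
  have h2 : 0 ≤ a * x i ^ 2 * w ^ 2 := by positivity
  have h3 : q * w ^ 2 ≤ 1 := by nlinarith
  rw [abs_le]
  constructor <;> nlinarith

/-- With `q = a|x|²` and `w = 1 / (1 + q)` the divergence is `n w - 2 q w²`; use `w ≥ 1 - q` and `w
≤ 1`. The bound is affine in `|x|²`, so only the second moment is needed. -/
theorem sum_fderiv_coord_div_single_ge (a : ℝ) (ha : 0 < a) (x : EuclideanSpace ℝ (Fin n)) :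
    n - (n + 2) * a * ‖x‖ ^ 2 ≤
      ∑ i, fderiv ℝ (fun x : EuclideanSpace ℝ (Fin n) => x i * (1 + a * ‖x‖ ^ 2)⁻¹) x
        (EuclideanSpace.single i 1) := by
  simp_rw [fderiv_coord_div_single a ha, Finset.sum_sub_distrib, ← Finset.sum_mul,
    ← Finset.mul_sum, ← EuclideanSpace.real_norm_sq_eq]
  simp only [Finset.sum_const, Finset.card_univ, Fintype.card_fin, nsmul_eq_mul]
  rw [mul_assoc, mul_assoc]
  set q := a * ‖x‖ ^ 2 with hq
  have hq0 : 0 ≤ q := by positivity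
  set w := (1 + q)⁻¹ with hw
  have hw0 : 0 ≤ w := by positivity
  have hwq : w + w * q = 1 := by rw [hw]; field_simp
  have hw1 : w ≤ 1 := by nlinarith [mul_nonneg hw0 hq0]
  have h1 : (n : ℝ) * (1 - q) ≤ n * w :=
    mul_le_mul_of_nonneg_left (by nlinarith) (Nat.cast_nonneg n)
  have h2 : q * w ^ 2 ≤ q := mul_le_of_le_one_right hq0 (pow_le_one₀ hw0 hw1)
  nlinarith

end Field

/-! ### The lower bound. -/

/-- Lower bound for the total variation of an essentially continuous log-concave function in
terms of its second moment. -/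
theorem integral_norm_fderiv_ge {m : ℕ} {f : EuclideanSpace ℝ (Fin (m + 1)) → ℝ} (hf : IsLC f)
    (hD : IsEssentiallyContinuous f) (hfi : Integrable f) (hf1 : ∫ x, f x = 1)
    (hf2i : Integrable fun x => ‖x‖ ^ 2 * f x) (hf2 : ∫ x, ‖x‖ ^ 2 * f x = (m + 1 : ℕ))
    (hf' : Integrable (fderiv ℝ f)) :
    4 / 9 * √((m + 1 : ℕ) : ℝ) ≤ ∫ x, ‖fderiv ℝ f x‖ := by
  set N : ℝ := ((m + 1 : ℕ) : ℝ) with hN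
  have hN1 : 1 ≤ N := by rw [hN]; exact_mod_cast Nat.succ_le_succ (Nat.zero_le m)
  have hs0 : 0 < √N := Real.sqrt_pos.2 (by linarith)
  -- At this scale the field is bounded by `3/2 * √N`, while the loss in divergence is `(N + 2) / 9
  -- ≤ N / 3`, leaving `2N / 3`.
  set a : ℝ := (9 * N)⁻¹ with ha
  have ha0 : 0 < a := by positivity
  have hsqrt : (2 * √a)⁻¹ = 3 / 2 * √N := by
    rw [ha, Real.sqrt_inv, Real.sqrt_mul (by norm_num), show (9 : ℝ) = 3 ^ 2 by norm_num,
      Real.sqrt_sq (by norm_num)]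
    field_simp
  let φ : Fin (m + 1) → EuclideanSpace ℝ (Fin (m + 1)) → ℝ := fun i x =>
    x i * (1 + a * ‖x‖ ^ 2)⁻¹
  let e : Fin (m + 1) → EuclideanSpace ℝ (Fin (m + 1)) := fun i => EuclideanSpace.single i 1
  have hφ : ∀ i, ContDiff ℝ 1 (φ i) := fun i => contDiff_coord_div a ha0 i
  have hf'e : ∀ i, Integrable fun x => fderiv ℝ f x (e i) := fun i => hf'.apply_continuousLinearMap _
  have hibp : ∀ i, ∫ x, fderiv ℝ (φ i) x (e i) * f x = -∫ x, φ i x * fderiv ℝ f x (e i) :=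
    fun i => integral_partial_mul_eq_neg hf hD hfi i (hf'e i) (hφ i)
      (C := max (2 * √a)⁻¹ 2) (fun x => (abs_coord_div_le a ha0 i x).trans (le_max_left _ _))
      (fun x => (abs_fderiv_coord_div_single_le a ha0 i x).trans (le_max_right _ _))
  have hi1 : ∀ i, Integrable fun x => fderiv ℝ (φ i) x (e i) * f x := fun i =>
    hfi.bdd_mul (((hφ i).continuous_fderiv one_ne_zero).clm_apply
      continuous_const).aestronglyMeasurable
      (.of_forall (abs_fderiv_coord_div_single_le a ha0 i))
  have hi2 : ∀ i, Integrable fun x => φ i x * fderiv ℝ f x (e i) := fun i =>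
    (hf'e i).bdd_mul (hφ i).continuous.aestronglyMeasurable
      (.of_forall (abs_coord_div_le a ha0 i))
  have hsum : ∫ x, ∑ i, fderiv ℝ (φ i) x (e i) * f x = ∫ x, -∑ i, φ i x * fderiv ℝ f x (e i) := by
    rw [integral_neg, integral_finsetSum _ fun i _ => hi1 i, integral_finsetSum _ fun i _ => hi2 i,
      ← Finset.sum_neg_distrib]
    exact Finset.sum_congr rfl fun i _ => hibp i
  have hlow : N - (N + 2) * a * N ≤ ∫ x, ∑ i, fderiv ℝ (φ i) x (e i) * f x := by
    have : ∫ x, (N * f x - (N + 2) * a * (‖x‖ ^ 2 * f x)) = N - (N + 2) * a * N := by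
      rw [integral_sub (hfi.const_mul _) (hf2i.const_mul _), integral_const_mul,
        integral_const_mul, hf1, hf2, mul_one]
    rw [← this]
    refine integral_mono ((hfi.const_mul _).sub (hf2i.const_mul _))
      (integrable_finsetSum _ fun i _ => hi1 i) fun x => ?_
    have := mul_le_mul_of_nonneg_right (sum_fderiv_coord_div_single_ge a ha0 x) (hf.nonneg x)
    rw [Finset.sum_mul] at this
    refine le_trans (le_of_eq ?_) this
    simp only [hN]
    ring
  have hup : ∫ x, -∑ i, φ i x * fderiv ℝ f x (e i) ≤ 3 / 2 * √N * ∫ x, ‖fderiv ℝ f x‖ := by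
    rw [← integral_const_mul]
    refine integral_mono (integrable_finsetSum _ fun i _ => hi2 i).neg (hf'.norm.const_mul _)
      fun x => ?_
    have hw : 0 < (1 + a * ‖x‖ ^ 2)⁻¹ := by positivity
    have hx : ∑ i, φ i x * fderiv ℝ f x (e i) = fderiv ℝ f x ((1 + a * ‖x‖ ^ 2)⁻¹ • x) := by
      have hxs : x = ∑ i, x i • e i := by
        ext j
        simp [e, Finset.sum_apply, Pi.single_apply]
      conv_rhs => rw [map_smul, hxs, map_sum, Finset.smul_sum]
      refine Finset.sum_congr rfl fun i _ => ?_
      rw [map_smul, smul_eq_mul, smul_eq_mul, ← hxs]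
      simp only [φ]
      ring
    rw [hx]
    calc -fderiv ℝ f x ((1 + a * ‖x‖ ^ 2)⁻¹ • x)
        ≤ ‖fderiv ℝ f x ((1 + a * ‖x‖ ^ 2)⁻¹ • x)‖ := neg_le_abs _
      _ ≤ ‖fderiv ℝ f x‖ * ‖(1 + a * ‖x‖ ^ 2)⁻¹ • x‖ := ContinuousLinearMap.le_opNorm _ _
      _ = ‖x‖ * (1 + a * ‖x‖ ^ 2)⁻¹ * ‖fderiv ℝ f x‖ := by
        rw [norm_smul, Real.norm_of_nonneg hw.le]; ring
      _ ≤ 3 / 2 * √N * ‖fderiv ℝ f x‖ := by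
        rw [← hsqrt]
        exact mul_le_mul_of_nonneg_right (norm_mul_inv_le a ha0 _) (norm_nonneg _)
  have haN : (N + 2) * a * N ≤ N / 3 := by
    have : a * N = 1 / 9 := by rw [ha]; field_simp
    rw [mul_assoc, this]
    linarith
  have hfin : √N * (4 / 9 * √N) ≤ √N * ∫ x, ‖fderiv ℝ f x‖ := by
    have := Real.mul_self_sqrt (show 0 ≤ N by linarith)
    nlinarith [hlow.trans (hsum.le.trans hup)]
  exact le_of_mul_le_mul_left hfin hs0

theorem proposition5p4 :
    ∃ c : ℝ, 0 < c ∧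
      ∀ (n : ℕ) (μ : Measure (EuclideanSpace ℝ (Fin n))) (f : EuclideanSpace ℝ (Fin n) → ℝ)
        (ψ : EuclideanSpace ℝ (Fin n) → EReal),
        IsProbabilityMeasure μ → IsLogConcaveMeasure μ → IsIsotropic μ →
        IsLC f → IsEssentiallyContinuous f →
        μ = volume.withDensity (fun x => ENNReal.ofReal (f x)) →
        (∀ x, ENNReal.ofReal (f x) = EReal.exp (-ψ x)) →
        ENNReal.ofReal (c * Real.sqrt n) ≤
          ∫⁻ x, ‖gradient (fun y => (ψ y).toReal) x‖ₑ ∂μ := by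
  refine ⟨4 / 9, by norm_num, fun n μ f ψ hμ _ hiso hf hD hμf hψ => ?_⟩
  rcases n with _ | m
  · simp
  have hψ' : (fun y => (ψ y).toReal) = fun y => -Real.log (f y) :=
    funext fun y => toReal_eq_neg_log_of_ofReal_eq_exp_neg (hf.nonneg y) (hψ y)
  have hfm : Measurable f := hf.upperSemicontinuous.measurable
  have hlint : ∫⁻ x, ENNReal.ofReal (f x) = 1 := by
    have := hμ.measure_univ
    rwa [hμf, withDensity_apply _ MeasurableSet.univ, Measure.restrict_univ] at this
  have hfi : Integrable f := by
    refine ⟨hfm.aestronglyMeasurable, ?_⟩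
    rw [hasFiniteIntegral_iff_ofReal (.of_forall hf.nonneg), hlint]
    exact ENNReal.one_lt_top
  have hf1 : ∫ x, f x = 1 := by
    rw [integral_eq_lintegral_of_nonneg_ae (.of_forall hf.nonneg) hfm.aestronglyMeasurable, hlint]
    rfl
  have hg : ∫⁻ x, ‖gradient (fun y => (ψ y).toReal) x‖ₑ ∂μ = ∫⁻ x, ‖fderiv ℝ f x‖ₑ := by
    rw [hψ', hμf, lintegral_withDensity_eq_lintegral_mul _ hfm.ennreal_ofReal]
    · refine lintegral_congr_ae ?_
      filter_upwards [ae_differentiableAt_of_logConcave volume hf.nonneg hf.logConcave] with x hx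
      exact (enorm_fderiv_eq_mul_enorm_gradient_log hf.nonneg hx).symm
    · exact ((InnerProductSpace.toDual ℝ _).symm.continuous.measurable.comp
        (measurable_fderiv ℝ _)).enorm
  rw [hg]
  -- If the total variation is infinite there is nothing to prove; otherwise `fderiv ℝ f` is
  -- integrable, as integration by parts requires.
  by_cases htop : ∫⁻ x, ‖fderiv ℝ f x‖ₑ = ⊤
  · rw [htop]
    exact le_top
  have hf' : Integrable (fderiv ℝ f) :=
    ⟨(measurable_fderiv ℝ f).aestronglyMeasurable, lt_top_iff_ne_top.2 htop⟩
  obtain ⟨h2i, h2⟩ := hiso.integral_norm_sq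
  have hcongr : ∀ x : EuclideanSpace ℝ (Fin (m + 1)),
      (ENNReal.ofReal (f x)).toReal • ‖x‖ ^ 2 = ‖x‖ ^ 2 * f x := fun x => by
    rw [ENNReal.toReal_ofReal (hf.nonneg x), smul_eq_mul, mul_comm]
  rw [hμf, integrable_withDensity_iff_integrable_smul' hfm.ennreal_ofReal
    (.of_forall fun x => ENNReal.ofReal_lt_top)] at h2i
  rw [hμf, integral_withDensity_eq_integral_toReal_smul hfm.ennreal_ofReal
    (.of_forall fun x => ENNReal.ofReal_lt_top)] at h2
  simp_rw [hcongr] at h2i h2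
  rw [← ofReal_integral_norm_eq_lintegral_enorm hf']
  exact ENNReal.ofReal_le_ofReal (integral_norm_fderiv_ge hf hD hfi hf1 h2i h2 hf')
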